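/- Let $R$ be a commutative noetherian ring. For an $R$-module $M$ let $E(M)$ denote its injective hull, and let $\mho^i M$ ($i\ge 0$) denote the $i$-th cosyzygy in the minimal injective coresolution of $M$, i.e. $\mho^0M=M$ and $\mho^{i+1}M=E(\mho^iM)/\mho^iM$. For $Y\subseteq\operatorname{Spec}R$ let $\mathcal I(Y)=\operatorname{Add}\bigl(\bigoplus_{\mathfrak p\in Y}E(R/\mathfrak p)\bigr)$ be the class of all modules isomorphic to a direct summand of a direct sum of copies of $\bigoplus_{\mathfrak p\in Y}E(R/\mathfrak p)$. For a class $\mathcal C$ of modules, a $\mathcal C$-precover of $M$ is a homomorphism $f\colon C\to M$ with $C\in\mathcal C$ such that every homomorphism $C'\to M$ with $C'\in\mathcal C$ factors through $f$. Let $Y_0\subseteq Y_1\subseteq Y_2\subseteq\cdots$ be subsets of $\operatorname{Spec}R$, each closed under generalization (if $\mathfrak q\in Y_k$ and $\mathfrak p\subseteq\mathfrak q$ is prime, then $\mathfrak p\in Y_k$), and assume that $\operatorname{Ass}(\mho^kR)\subseteq Y_k$ for all $k\ge 0$. Let $i\ge 0$, let $E$ be an injective $R$-module, and let $$0\to C\to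 E_0\xrightarrow{\varphi_0}E_1\to\cdots\to E_{i-1}\xrightarrow{\varphi_{i-1}}E_i\xrightarrow{\varphi_i}E\to 0$$ be any complex such that $C\to E_0$ is the kernel of $\varphi_0$, the map $\varphi_i$ is an $\mathcal I(Y_i)$-precover of $E$, and for each $j<i$ the map $\varphi_j$ factors as $\varphi_j=\nu_{j+1}\circ\Phi_j$, where $\nu_{j+1}\colon K_{j+1}\to E_{j+1}$ is the kernel of $\varphi_{j+1}$ and $\Phi_j\colon E_j\to K_{j+1}$ is an $\mathcal I(Y_j)$-precover of $K_{j+1}$. Then this complex is exact; that is, all the maps $\Phi_j$ ($0\le j<i$) and the precover $\varphi_i$ are surjective. -/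

import Mathlib

universe u

open scoped DirectSum

namespace InjPrecover

variable {R : Type u} [CommRing R]

/-- `ι : M → E` is an injective hull: `E` is injective, `ι` is a monomorphism, and its image is an
essential submodule (it meets every nonzero submodule of `E` nontrivially). -/
structure IsInjectiveHull {M E : Type u} [AddCommGroup M] [Module R M] [AddCommGroup E]
    [Module R E] (ι : M →ₗ[R] E) : Prop where
  injective_module : Module.Injective R E
  injective_map : Function.Injective ι
  essential : ∀ N : Submodule R E, LinearMap.range ι ⊓ N = ⊥ → N = ⊥

/-- The submodules of `J` which contain `A` and in which `A` is essential. -/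
def essentialExtensions {J : Type u} [AddCommGroup J] [Module R J] (A : Submodule R J) :
    Set (Submodule R J) :=
  {B | A ≤ B ∧ ∀ x ∈ B, x ≠ 0 → ∃ r : R, r • x ≠ 0 ∧ r • x ∈ A}

theorem exists_maximal_essential {J : Type u} [AddCommGroup J] [Module R J]
    (A : Submodule R J) : ∃ B, Maximal (· ∈ essentialExtensions A) B := by
  obtain ⟨B, -, hB⟩ := zorn_le_nonempty₀ (essentialExtensions A)
    (fun c hc hch y hy => by
      refine ⟨sSup c, ⟨(hc hy).1.trans (le_sSup hy), fun x hx hx0 => ?_⟩, fun z hz => le_sSup hz⟩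
      rw [Submodule.mem_sSup_of_directed ⟨y, hy⟩ hch.directedOn] at hx
      obtain ⟨z, hz, hxz⟩ := hx
      exact (hc hz).2 x hxz hx0)
    A ⟨le_rfl, fun x hx hx0 => ⟨1, by simpa using hx0, by simpa using hx⟩⟩
  exact ⟨B, hB⟩

theorem exists_maximal_disjoint {J : Type u} [AddCommGroup J] [Module R J]
    (B : Submodule R J) : ∃ N, Maximal (fun N : Submodule R J => ∀ x ∈ B, x ∈ N → x = 0) N := by
  obtain ⟨N, -, hN⟩ := zorn_le_nonempty₀ {N : Submodule R J | ∀ x ∈ B, x ∈ N → x = 0}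
    (fun c hc hch y hy => by
      refine ⟨sSup c, fun x hxB hx => ?_, fun z hz => le_sSup hz⟩
      rw [Submodule.mem_sSup_of_directed ⟨y, hy⟩ hch.directedOn] at hx
      obtain ⟨z, hz, hxz⟩ := hx
      exact hc hz x hxB hxz)
    ⊥ (fun x _ hx => by simpa using hx)
  exact ⟨N, hN⟩

/-- A maximal essential extension inside an injective module is a direct summand. -/
theorem exists_retraction {J : Type u} [AddCommGroup J] [Module R J] [Module.Injective R J]
    (A B : Submodule R J) (hB : Maximal (· ∈ essentialExtensions A) B) :
    ∃ r : J →ₗ[R] B, ∀ x : B, r x = x := by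
  obtain ⟨N, hN⟩ := exists_maximal_disjoint B
  have hN0 := hN.prop
  have hinj : Function.Injective (N.mkQ ∘ₗ B.subtype) := by
    rw [← LinearMap.ker_eq_bot, LinearMap.ker_eq_bot']
    intro x hx
    have hx' : (x : J) ∈ N := by simpa using hx
    exact Subtype.ext (hN0 x x.2 hx')
  obtain ⟨g, hg⟩ := Module.Injective.out (N.mkQ ∘ₗ B.subtype) hinj B.subtype
  have hg' : ∀ b ∈ B, g (N.mkQ b) = b := fun b hb => hg ⟨b, hb⟩
  -- every element outside `N` has a multiple which is nonzero in `B` modulo `N`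
  have key : ∀ j : J, j ∉ N → ∃ r : R, ∃ b ∈ B, b ≠ 0 ∧ r • j - b ∈ N := by
    intro j hj
    by_contra hcon
    push Not at hcon
    have hle : N ⊔ Submodule.span R {j} ≤ N := by
      refine hN.le_of_ge ?_ le_sup_left
      intro x hxB hx
      obtain ⟨n, hn, y, hy, rfl⟩ := Submodule.mem_sup.1 hx
      obtain ⟨r, rfl⟩ := Submodule.mem_span_singleton.1 hy
      by_contra hne
      refine hcon r _ hxB hne ?_
      have : r • j - (n + r • j) = -n := by abel
      rw [this]
      exact N.neg_mem hn
    exact hj (hle (Submodule.mem_sup_right (Submodule.mem_span_singleton_self j)))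
  have hrange : LinearMap.range g ∈ essentialExtensions A := by
    refine ⟨fun a ha => ⟨N.mkQ a, hg' a (hB.prop.1 ha)⟩, ?_⟩
    rintro _ ⟨q, rfl⟩ hq
    obtain ⟨j, rfl⟩ := N.mkQ_surjective q
    have hj : j ∉ N := by
      intro hj
      apply hq
      have : N.mkQ j = 0 := by simpa using hj
      rw [this, map_zero]
    obtain ⟨r, b, hb, hb0, hrb⟩ := key j hj
    have h1 : r • g (N.mkQ j) = b := by
      rw [← map_smul, ← map_smul, ← hg' b hb]
      congr 1
      exact (Submodule.Quotient.eq N).2 hrb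
    obtain ⟨s, hs0, hsA⟩ := hB.prop.2 b hb hb0
    exact ⟨s * r, by rwa [mul_smul, h1], by rwa [mul_smul, h1]⟩
  have hle : LinearMap.range g ≤ B :=
    hB.le_of_ge hrange fun b hb => ⟨N.mkQ b, hg' b hb⟩
  refine ⟨(g ∘ₗ N.mkQ).codRestrict B fun x => hle ⟨_, rfl⟩, fun x => ?_⟩
  exact Subtype.ext (hg' x x.2)

variable (R) in
/-- Every module has an injective hull. -/
theorem exists_injectiveHull (M : Type u) [AddCommGroup M] [Module R M] :
    ∃ (E : ModuleCat.{u} R) (ι : M →ₗ[R] E), IsInjectiveHull ι := by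
  let J := CategoryTheory.Injective.under (ModuleCat.of R M)
  let i : M →ₗ[R] J := (CategoryTheory.Injective.ι (ModuleCat.of R M)).hom
  have hi : Function.Injective i := (ModuleCat.mono_iff_injective _).1 inferInstance
  have hJ : Module.Injective R J := by
    have : CategoryTheory.Injective (ModuleCat.of R J) :=
      inferInstanceAs (CategoryTheory.Injective J)
    exact Module.injective_module_of_injective_object R J
  obtain ⟨B, hB⟩ := exists_maximal_essential (LinearMap.range i)
  obtain ⟨r, hr⟩ := exists_retraction _ B hB
  refine ⟨ModuleCat.of R B, i.codRestrict B fun x => hB.prop.1 ⟨x, rfl⟩, ?_, ?_, ?_⟩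
  · constructor
    intro X Y _ _ _ _ f hf g
    obtain ⟨h, hh⟩ := hJ.out f hf (B.subtype ∘ₗ g)
    refine ⟨r ∘ₗ h, fun x => ?_⟩
    have := hh x
    simp only [LinearMap.comp_apply] at this ⊢
    rw [this]
    exact hr (g x)
  · intro x y hxy
    exact hi (congrArg Subtype.val hxy)
  · intro N hN
    rw [Submodule.eq_bot_iff]
    intro x hx
    by_contra hx0
    obtain ⟨s, hs0, m, hm⟩ := hB.prop.2 x.1 x.2 (fun h => hx0 (Subtype.ext h))
    have hmem : s • x ∈ (⊥ : Submodule R B) := by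
      rw [← hN]
      exact ⟨⟨m, Subtype.ext hm⟩, N.smul_mem s hx⟩
    exact hs0 (congrArg Subtype.val ((Submodule.mem_bot R).1 hmem))

variable (R) in
/-- The injective hull `E(M)`. -/
noncomputable def injectiveHull (M : Type u) [AddCommGroup M] [Module R M] : ModuleCat.{u} R :=
  (exists_injectiveHull R M).choose

variable (R) in
/-- The embedding `M → E(M)`. -/
noncomputable def toInjectiveHull (M : Type u) [AddCommGroup M] [Module R M] :
    M →ₗ[R] injectiveHull R M :=
  (exists_injectiveHull R M).choose_spec.choose

variable (R) in
theorem isInjectiveHull_toInjectiveHull (M : Type u) [AddCommGroup M] [Module R M] :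
    IsInjectiveHull (toInjectiveHull R M) :=
  (exists_injectiveHull R M).choose_spec.choose_spec

/-- The `i`-th cosyzygy `℧ⁱ M` in the minimal injective coresolution
`0 → M → E(M) → E(E(M)/M) → ⋯` of `M`: `℧⁰ M = M` and `℧ⁱ⁺¹ M = E(℧ⁱ M) / ℧ⁱ M`. -/
noncomputable def cosyzygy (M : ModuleCat.{u} R) : ℕ → ModuleCat.{u} R
  | 0 => M
  | i + 1 => ModuleCat.of R
      (injectiveHull R (cosyzygy M i) ⧸ LinearMap.range (toInjectiveHull R (cosyzygy M i)))

/-- `Add G`: the modules isomorphic to a direct summand of a direct sum of copies of `G`. -/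
def Add (G : ModuleCat.{u} R) (M : ModuleCat.{u} R) : Prop :=
  ∃ (κ : Type u) (s : M →ₗ[R] (κ →₀ G)) (r : (κ →₀ G) →ₗ[R] M), r ∘ₗ s = LinearMap.id

/-- `𝓘(Y) = Add (⨁_{𝔭 ∈ Y} E(R/𝔭))`. -/
def InjClass (Y : Set (PrimeSpectrum R)) : ModuleCat.{u} R → Prop :=
  Add (ModuleCat.of R (⨁ p : Y, injectiveHull R (R ⧸ p.1.asIdeal)))

/-- `f : C → M` is a `𝒞`-precover of `M`. -/
def IsPrecover (𝒞 : ModuleCat.{u} R → Prop) {C M : ModuleCat.{u} R} (f : C →ₗ[R] M) : Prop :=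
  𝒞 C ∧ ∀ (C' : ModuleCat.{u} R), 𝒞 C' → ∀ f' : C' →ₗ[R] M,
    ∃ g : C' →ₗ[R] C, f' = f ∘ₗ g

/-- The data of a complex
`0 → K₀ → E₀ → E₁ → ⋯ → Eᵢ → Eᵢ₊₁ → 0` with maps `φ j : E j → E (j + 1)` for `j ≤ i`, where
`K₀` is the kernel of `φ 0`, obtained by iterating precovers: `φ i` is an
`𝓘(Y i)`-precover of the last module `E (i + 1)`, and, for `j < i`, the map `φ j` is an
`𝓘(Y j)`-precover `Φ j` of the kernel `ν (j + 1) : K (j + 1) → E (j + 1)` of `φ (j + 1)`,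
followed by `ν (j + 1)`.
The families are indexed by `ℕ` for convenience only: nothing is required of `E j` for
`j > i + 1` or of the maps and kernels with index `> i` (nor of `Φ i`). -/
structure PrecoverComplex (Y : ℕ → Set (PrimeSpectrum R)) (i : ℕ) where
  E : ℕ → ModuleCat.{u} R
  K : ℕ → ModuleCat.{u} R
  φ : ∀ j, E j →ₗ[R] E (j + 1)
  ν : ∀ j, K j →ₗ[R] E j
  Φ : ∀ j, E j →ₗ[R] K (j + 1)
  ν_injective : ∀ j ≤ i, Function.Injective (ν j)
  range_ν : ∀ j ≤ i, LinearMap.range (ν j) = LinearMap.ker (φ j)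
  precover_last : IsPrecover (InjClass (Y i)) (φ i)
  factorization : ∀ j < i, φ j = ν (j + 1) ∘ₗ Φ j
  precover : ∀ j < i, IsPrecover (InjClass (Y j)) (Φ j)

/-- Exactness of `0 → K₀ → E₀ → E₁ → ⋯ → Eᵢ → Eᵢ₊₁ → 0` at every term. -/
structure PrecoverComplex.IsExact {Y : ℕ → Set (PrimeSpectrum R)} {i : ℕ}
    (P : PrecoverComplex Y i) : Prop where
  exact_K : Function.Injective (P.ν 0)
  exact_zero : Function.Exact (P.ν 0) (P.φ 0)
  exact_succ : ∀ j < i, Function.Exact (P.φ j) (P.φ (j + 1))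
  exact_last : Function.Surjective (P.φ i)

end InjPrecover

namespace InjPrecover

variable {R : Type u} [CommRing R]

/-! An element of `K` is a map `R → K`. If that map extends to `E(R)`, and `E(R)` lies in the class,
the extension lifts through a precover `Φ` of `K`, and the image of `1` is a preimage of the
element. So it suffices to extend maps `R → K_j` to `E(R)`. This is done by dimension shifting
(`exists_extension_ker`): if maps `℧ᵏ⁺¹R → K` extend to the hull, then so do maps `℧ᵏR → ker Φ`,
provided `E(℧ᵏ⁺¹R)` lies in the class. The last module is injective, so it has the property for all
`k`; descending along the complex, `K_j` has it for all `k < j`. The hulls lie in the right classes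
because `E(M)` has no associated primes beyond those of `M`, and over a noetherian ring an injective
module is a direct sum of hulls `E(R/p)` with `p` associated
(`injClass_of_associatedPrimes_subset`). -/

/-- A retract of an injective module is injective. -/
theorem injective_of_retract {M Q : Type u} [AddCommGroup M] [Module R M] [AddCommGroup Q]
    [Module R Q] (hQ : Module.Injective R Q) (s : M →ₗ[R] Q) (r : Q →ₗ[R] M)
    (hrs : r ∘ₗ s = LinearMap.id) : Module.Injective R M := by
  constructor
  intro X Y _ _ _ _ f hf g
  obtain ⟨h, hh⟩ := hQ.out f hf (s ∘ₗ g)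
  refine ⟨r ∘ₗ h, fun x => ?_⟩
  simp only [LinearMap.comp_apply, hh]
  exact LinearMap.congr_fun hrs (g x)

/-- Over a noetherian ring, direct sums of injective modules are injective. -/
theorem injective_dfinsupp [IsNoetherianRing R] {ι : Type u} {N : ι → Type u}
    [∀ i, AddCommGroup (N i)] [∀ i, Module R (N i)] (hN : ∀ i, Module.Injective R (N i)) :
    Module.Injective R (Π₀ i, N i) := by
  classical
  apply Module.Baer.injective
  intro I f
  obtain ⟨s, hs⟩ := (inferInstance : Module.Finite R I).fg_top
  -- Since `I` is finitely generated, all values of `f` are supported in one finite set, so Baer's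
  -- criterion can be applied coordinatewise.
  let T : Finset ι := s.biUnion fun x => (f x).support
  have hT : ∀ x : I, ∀ i ∉ T, f x i = 0 := by
    intro x i hi
    have hx : x ∈ Submodule.span R (s : Set I) := hs ▸ Submodule.mem_top
    induction hx using Submodule.span_induction with
    | mem x hx =>
      by_contra h
      exact hi (Finset.mem_biUnion.2 ⟨x, hx, DFinsupp.mem_support_iff.2 h⟩)
    | zero => simp
    | add x y _ _ hx hy => simp [hx, hy]
    | smul a x _ hx => simp [hx]
  choose g hg using fun i => Module.Baer.of_injective (hN i) I (DFinsupp.lapply i ∘ₗ f)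
  refine ⟨LinearMap.toSpanSingleton R _ (DFinsupp.mk T fun i => g i 1), fun x hx => ?_⟩
  ext i
  by_cases hi : i ∈ T
  · have : x • g i 1 = f ⟨x, hx⟩ i := by
      rw [← map_smul, smul_eq_mul, mul_one]
      exact hg i x hx
    simpa [DFinsupp.mk_apply, hi] using this
  · simp [DFinsupp.mk_apply, hi, hT _ i hi]

theorem injective_injectiveHull (M : Type u) [AddCommGroup M] [Module R M] :
    Module.Injective R (injectiveHull R M) :=
  (isInjectiveHull_toInjectiveHull R M).injective_module

/-- Over a noetherian ring, the modules in `𝓘(Y)` are injective. -/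
theorem InjClass.injective [IsNoetherianRing R] {Y : Set (PrimeSpectrum R)} {M : ModuleCat.{u} R}
    (hM : InjClass Y M) : Module.Injective R M := by
  classical
  obtain ⟨κ, s, r, hrs⟩ := hM
  refine injective_of_retract ?_ s r hrs
  have h : Module.Injective R (⨁ p : Y, injectiveHull R (R ⧸ p.1.asIdeal)) :=
    injective_dfinsupp fun p => injective_injectiveHull _
  have h' : Module.Injective R
      (Π₀ _ : κ, ModuleCat.of R (⨁ p : Y, injectiveHull R (R ⧸ p.1.asIdeal))) :=
    injective_dfinsupp fun _ => h
  refine injective_of_retract h' (finsuppLequivDFinsupp R).toLinearMap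
    (finsuppLequivDFinsupp R).symm.toLinearMap ?_
  ext1 x
  simp

/-! ### Injective hulls and associated primes -/

theorem IsInjectiveHull.exists_smul_mem {M E : Type u} [AddCommGroup M] [Module R M]
    [AddCommGroup E] [Module R E] {ι : M →ₗ[R] E} (hι : IsInjectiveHull ι) {x : E} (hx : x ≠ 0) :
    ∃ (r : R) (m : M), ι m = r • x ∧ r • x ≠ 0 := by
  by_contra! hcon
  have := hι.essential (R ∙ x) (by
    rw [Submodule.eq_bot_iff]
    rintro _ ⟨⟨m, rfl⟩, hm⟩
    obtain ⟨r, hr⟩ := Submodule.mem_span_singleton.1 hm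
    rw [← hr]
    exact hcon r m hr.symm)
  exact hx (Submodule.span_singleton_eq_bot.1 this)

/-- A map out of an injective hull is injective if it is injective on the module. -/
theorem IsInjectiveHull.injective_of_comp {M E X : Type u} [AddCommGroup M] [Module R M]
    [AddCommGroup E] [Module R E] [AddCommGroup X] [Module R X] {ι : M →ₗ[R] E}
    (hι : IsInjectiveHull ι) (f : E →ₗ[R] X) (hf : Function.Injective (f ∘ₗ ι)) :
    Function.Injective f := by
  rw [← LinearMap.ker_eq_bot]
  apply hι.essential
  rw [Submodule.eq_bot_iff]
  rintro _ ⟨⟨m, rfl⟩, hm⟩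
  rw [hf (a₁ := m) (a₂ := 0) (by simpa using hm), map_zero]

/-- Every associated prime of the injective hull of `M` is an associated prime of `M`. -/
theorem IsInjectiveHull.associatedPrimes_subset [IsNoetherianRing R] {M E : Type u}
    [AddCommGroup M] [Module R M] [AddCommGroup E] [Module R E] {ι : M →ₗ[R] E}
    (hι : IsInjectiveHull ι) : associatedPrimes R E ⊆ associatedPrimes R M := by
  intro p hp
  obtain ⟨hprime, x, hx⟩ := isAssociatedPrime_iff.1 hp
  have hmem : ∀ a : R, a ∈ p ↔ a • x = 0 := by
    intro a
    rw [hx, Submodule.mem_colon_singleton, Submodule.mem_bot]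
  have hx0 : x ≠ 0 := by
    rintro rfl
    exact hprime.ne_top ((Ideal.eq_top_iff_one p).2 ((hmem 1).2 (smul_zero _)))
  -- As `p` is prime, any nonzero multiple of `x` still has annihilator `p`; essentiality puts one
  -- in the image of `M`.
  obtain ⟨r, m, hm, hr⟩ := hι.exists_smul_mem hx0
  refine isAssociatedPrime_iff.2 ⟨hprime, m, ?_⟩
  ext a
  rw [Submodule.mem_colon_singleton, Submodule.mem_bot, ← map_eq_zero_iff ι hι.injective_map,
    map_smul, hm, smul_smul, ← hmem]
  exact ⟨fun h => p.mul_mem_right r h,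
    fun h => (hprime.mem_or_mem h).resolve_right fun h => hr ((hmem r).1 h)⟩

/-- An associated prime `p` of an injective module `T` gives a copy of `E(R/p)` in `T`. -/
theorem exists_injectiveHull_injective [IsNoetherianRing R] {T : Type u} [AddCommGroup T]
    [Module R T] (hT : Module.Injective R T) {p : Ideal R} (hp : p ∈ associatedPrimes R T) :
    ∃ f : injectiveHull R (R ⧸ p) →ₗ[R] T, Function.Injective f := by
  obtain ⟨-, x, hx⟩ := isAssociatedPrime_iff.1 hp
  have hmem : ∀ a : R, a ∈ p ↔ a • x = 0 := by
    intro a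
    rw [hx, Submodule.mem_colon_singleton, Submodule.mem_bot]
  let g : (R ⧸ p) →ₗ[R] T := Submodule.liftQ p (LinearMap.toSpanSingleton R T x) fun a ha => by
    simpa using (hmem a).1 ha
  have hg : Function.Injective g := by
    rw [← LinearMap.ker_eq_bot]
    refine Submodule.ker_liftQ_eq_bot _ _ _ fun a ha => (hmem a).2 (by simpa using ha)
  have hull := isInjectiveHull_toInjectiveHull R (R ⧸ p)
  obtain ⟨f, hf⟩ := hT.out (toInjectiveHull R (R ⧸ p)) hull.injective_map g
  refine ⟨f, hull.injective_of_comp f ?_⟩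
  convert hg using 1
  exact funext hf

/-! ### Decomposition of injective modules -/

theorem sSupIndep_insert {α : Type*} [CompleteLattice α] [IsModularLattice α]
    {s : Set α} {a : α} (hs : sSupIndep s) (ha : Disjoint a (sSup s)) :
    sSupIndep (insert a s) := by
  intro b hb
  by_cases hba : b = a
  · subst hba
    refine ha.mono_right (sSup_le_sSup ?_)
    rintro c ⟨hc | hc, hcb⟩
    · exact absurd hc hcb
    · exact hc
  · have hbs : b ∈ s := hb.resolve_left hba
    have h1 : Disjoint b (sSup (s \ {b})) := hs hbs
    have h2 : Disjoint (b ⊔ sSup (s \ {b})) a :=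
      (ha.mono_right (sup_le (le_sSup hbs) (sSup_le_sSup Set.sdiff_subset))).symm
    refine (h1.disjoint_sup_right_of_disjoint_sup_left h2).mono_right (sSup_le ?_)
    rintro c ⟨hc | hc, hcb⟩
    · exact hc ▸ le_sup_right
    · exact (le_sSup (show c ∈ s \ {b} from ⟨hc, hcb⟩)).trans le_sup_left

/-- A family of submodules isomorphic to modules `E(R/p)`, `p ∈ Y`, maximal among the independent
ones. -/
theorem exists_maximal_independent (Y : Set (PrimeSpectrum R)) (M : Type u) [AddCommGroup M]
    [Module R M] : ∃ S : Set (Submodule R M), Maximal (fun S : Set (Submodule R M) => sSupIndep S ∧ ∀ N ∈ S, ∃ p ∈ Y,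
      Nonempty (N ≃ₗ[R] injectiveHull R (R ⧸ p.asIdeal))) S := by
  refine zorn_subset {S : Set (Submodule R M) | sSupIndep S ∧ ∀ N ∈ S, ∃ p ∈ Y,
      Nonempty (N ≃ₗ[R] injectiveHull R (R ⧸ p.asIdeal))} fun c hc hch => ?_
  refine ⟨⋃₀ c, ⟨?_, ?_⟩, fun s hs => Set.subset_sUnion_of_mem hs⟩
  · exact iSupIndep_sUnion_of_directed hch.directedOn fun s hs => (hc hs).1
  · rintro N ⟨s, hs, hN⟩
    exact (hc hs).2 N hN

/-- Over a noetherian ring, an injective module all of whose associated primes are in `Y` is in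
`𝓘(Y)`. -/
theorem injClass_of_associatedPrimes_subset [IsNoetherianRing R] {Y : Set (PrimeSpectrum R)}
    {M : ModuleCat.{u} R} (hM : Module.Injective R M)
    (hAss : associatedPrimes R M ⊆ PrimeSpectrum.asIdeal '' Y) : InjClass Y M := by
  classical
  obtain ⟨S, hS⟩ := exists_maximal_independent Y M
  choose p hpY e using fun N : S => hS.prop.2 N N.2
  have e' : ∀ N : S, N.1 ≃ₗ[R] injectiveHull R (R ⧸ (p N).asIdeal) := fun N => (e N).some
  let σ : (Π₀ N : S, N.1) →ₗ[R] M := DFinsupp.lsum ℕ fun N : S => N.1.subtype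
  have hσ : Function.Injective σ := ((sSupIndep_iff S).1 hS.prop.1).dfinsupp_lsum_injective
  have hσS : LinearMap.range σ = sSup S := by
    rw [sSup_eq_iSup', Submodule.iSup_eq_range_dfinsupp_lsum]
  have hinj : Module.Injective R (Π₀ N : S, N.1) :=
    injective_dfinsupp fun N => injective_of_retract (injective_injectiveHull _)
      (e' N).toLinearMap (e' N).symm.toLinearMap (by ext1; simp)
  obtain ⟨r, hr⟩ := hinj.out σ hσ LinearMap.id
  -- The complement `ker r` of the sum of the family is injective; were it nonzero, it would contain
  -- some `E(R/q)` with `q ∈ Y`, contradicting maximality.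
  have hker : LinearMap.ker r = ⊥ := by
    by_contra hne
    have hT : Module.Injective R (LinearMap.ker r) := by
      refine injective_of_retract hM (LinearMap.ker r).subtype
        ((LinearMap.id - σ ∘ₗ r).codRestrict _ fun x => by simp [hr]) ?_
      ext x
      simp
    obtain ⟨x, hx, hx0⟩ := Submodule.exists_mem_ne_zero_of_ne_bot hne
    obtain ⟨P, hP, -⟩ := exists_le_isAssociatedPrime_of_isNoetherianRing R
      (⟨x, hx⟩ : LinearMap.ker r) (by simpa using hx0)
    obtain ⟨q, hqY, rfl⟩ := hAss (hP.map_of_injective _ (LinearMap.ker r).subtype_injective)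
    obtain ⟨f, hf⟩ := exists_injectiveHull_injective hT hP
    let f' := (LinearMap.ker r).subtype ∘ₗ f
    have hf' : Function.Injective f' := (LinearMap.ker r).subtype_injective.comp hf
    have hdisj : Disjoint (LinearMap.range f') (sSup S) := by
      rw [Submodule.disjoint_def, ← hσS]
      rintro _ ⟨y, rfl⟩ ⟨z, hz⟩
      have : r (σ z) = 0 := by rw [hz]; exact (f y).2
      rw [hr, LinearMap.id_apply] at this
      rw [← hz, this, map_zero]
    have hmem : LinearMap.range f' ∈ S := by
      refine hS.le_of_ge ⟨sSupIndep_insert hS.prop.1 hdisj, ?_⟩ (Set.subset_insert _ _)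
        (Set.mem_insert _ S)
      rintro N (rfl | hN)
      · exact ⟨q, hqY, ⟨(LinearEquiv.ofInjective f' hf').symm⟩⟩
      · exact hS.prop.2 N hN
    have hf0 : f' = 0 := LinearMap.range_eq_bot.1 (hdisj.eq_bot_of_le (le_sSup hmem))
    have h1 : toInjectiveHull R (R ⧸ q.asIdeal) 1 = 0 := hf' (by rw [hf0]; rfl)
    have : (1 : R ⧸ q.asIdeal) = 0 :=
      (isInjectiveHull_toInjectiveHull R _).injective_map (by rw [h1, map_zero])
    exact one_ne_zero this
  have hrinj : Function.Injective r := LinearMap.ker_eq_bot.1 hker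
  let G := ModuleCat.of R (⨁ p : Y, injectiveHull R (R ⧸ p.1.asIdeal))
  -- Each member of the family gets its own copy of `G`, so repeated primes cause no clash; the
  -- resulting embedding of `M` splits by injectivity.
  let t : ∀ N : S, N.1 →ₗ[R] G := fun N =>
    DirectSum.lof R Y (fun p => injectiveHull R (R ⧸ p.1.asIdeal)) ⟨p N, hpY N⟩ ∘ₗ
      (e' N).toLinearMap
  have ht : ∀ N, Function.Injective (t N) := fun N =>
    (DirectSum.of_injective (β := fun p : Y => injectiveHull R (R ⧸ p.1.asIdeal)) _).comp
      (e' N).injective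
  let s : M →ₗ[R] (S →₀ G) := (finsuppLequivDFinsupp R).symm.toLinearMap ∘ₗ
    DFinsupp.mapRange.linearMap t ∘ₗ r
  have hs : Function.Injective s :=
    (finsuppLequivDFinsupp R).symm.injective.comp
      (((DFinsupp.mapRange_injective _ fun N => map_zero (t N)).2 ht).comp hrinj)
  obtain ⟨q, hq⟩ := hM.out s hs LinearMap.id
  exact ⟨S, s, q, LinearMap.ext hq⟩

/-! ### Dimension shifting along precovers -/

/-- If every map from the `(k + 1)`-st cosyzygy to `K` extends to its hull, and `Φ : E → K` is an
`𝓘(Y)`-precover, then every map from the `k`-th cosyzygy to the kernel of `Φ` extends to its hull,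
provided that the hull of the `(k + 1)`-st cosyzygy is in `𝓘(Y)`. -/
theorem exists_extension_ker [IsNoetherianRing R] {Y : Set (PrimeSpectrum R)}
    {A E K L : ModuleCat.{u} R} {Φ : E →ₗ[R] K} (hΦ : IsPrecover (InjClass Y) Φ) {ν : L →ₗ[R] E}
    (hν : Function.Injective ν) (hνΦ : LinearMap.range ν = LinearMap.ker Φ) (k : ℕ)
    (hk : InjClass Y (injectiveHull R (cosyzygy A (k + 1))))
    (hK : ∀ f : cosyzygy A (k + 1) →ₗ[R] K, ∃ g : injectiveHull R (cosyzygy A (k + 1)) →ₗ[R] K,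
      g ∘ₗ toInjectiveHull R (cosyzygy A (k + 1)) = f)
    (f : cosyzygy A k →ₗ[R] L) : ∃ g : injectiveHull R (cosyzygy A k) →ₗ[R] L,
      g ∘ₗ toInjectiveHull R (cosyzygy A k) = f := by
  have hL : ∀ y, Φ (ν y) = 0 := fun y => by
    rw [← LinearMap.mem_ker, ← hνΦ]
    exact ⟨y, rfl⟩
  let ι := toInjectiveHull R (cosyzygy A k)
  let π : injectiveHull R (cosyzygy A k) →ₗ[R] cosyzygy A (k + 1) := (LinearMap.range ι).mkQ
  obtain ⟨g, hg⟩ := hΦ.1.injective.out ι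
    (isInjectiveHull_toInjectiveHull R (cosyzygy A k)).injective_map (ν ∘ₗ f)
  have hg' : ∀ x, g (ι x) = ν (f x) := hg
  -- `g` may miss the kernel of `Φ`; `Φ ∘ₗ g` vanishes on `℧ᵏ`, so this obstruction lives on `℧ᵏ⁺¹`.
  let f₁ : cosyzygy A (k + 1) →ₗ[R] K := (LinearMap.range ι).liftQ (Φ ∘ₗ g) (by
    rintro _ ⟨x, rfl⟩
    simp [hg', hL])
  obtain ⟨h, hh⟩ := hK f₁
  obtain ⟨h', rfl⟩ := hΦ.2 _ hk h
  -- The correction cancels the obstruction and, since `π` kills `℧ᵏ`, leaves `g` unchanged there.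
  let d := g - h' ∘ₗ toInjectiveHull R (cosyzygy A (k + 1)) ∘ₗ π
  have hd : ∀ x, d x ∈ LinearMap.range ν := by
    intro x
    rw [hνΦ, LinearMap.mem_ker]
    have h1 : Φ (h' (toInjectiveHull R (cosyzygy A (k + 1)) (π x))) = Φ (g x) :=
      LinearMap.congr_fun hh (π x)
    simp [d, h1]
  refine ⟨(LinearEquiv.ofInjective ν hν).symm.toLinearMap ∘ₗ d.codRestrict _ hd, ?_⟩
  ext x
  apply hν
  have hπ : π (ι x) = 0 := (Submodule.Quotient.mk_eq_zero _).2 ⟨x, rfl⟩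
  have h2 : ν ((LinearEquiv.ofInjective ν hν).symm (d.codRestrict _ hd (ι x))) = d (ι x) :=
    congrArg Subtype.val ((LinearEquiv.ofInjective ν hν).apply_symm_apply _)
  refine h2.trans ?_
  simp [d, hπ, hg']

/-- A precover is surjective if its target extends all maps from `R` to the injective hull of `R`,
and this hull is in the class. -/
theorem IsPrecover.surjective {𝒞 : ModuleCat.{u} R → Prop} {E K : ModuleCat.{u} R}
    {Φ : E →ₗ[R] K} (hΦ : IsPrecover 𝒞 Φ) (hR : 𝒞 (injectiveHull R R))
    (hK : ∀ f : R →ₗ[R] K, ∃ g : injectiveHull R R →ₗ[R] K, g ∘ₗ toInjectiveHull R R = f) :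
    Function.Surjective Φ := by
  intro y
  obtain ⟨g, hg⟩ := hK (LinearMap.toSpanSingleton R K y)
  obtain ⟨h, rfl⟩ := hΦ.2 _ hR g
  refine ⟨h (toInjectiveHull R R 1), ?_⟩
  simpa using LinearMap.congr_fun hg 1

end InjPrecover

open InjPrecover in
theorem mainTheorem5 {R : Type u} [CommRing R] [IsNoetherianRing R]
    (Y : ℕ → Set (PrimeSpectrum R)) (hmono : Monotone Y) (hgen : ∀ i, IsLowerSet (Y i))
    (hAss : ∀ i, associatedPrimes R (InjPrecover.cosyzygy (ModuleCat.of R R) i) ⊆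
      PrimeSpectrum.asIdeal '' Y i)
    (i : ℕ) (P : InjPrecover.PrecoverComplex Y i) (hE : Module.Injective R (P.E (i + 1))) :
    P.IsExact ∧ (∀ j < i, Function.Surjective (P.Φ j)) ∧ Function.Surjective (P.φ i) := by
  have hcls : ∀ k j, k ≤ j → InjClass (Y j) (injectiveHull R (cosyzygy (ModuleCat.of R R) k)) :=
    fun k j hkj => injClass_of_associatedPrimes_subset (injective_injectiveHull _)
      (((isInjectiveHull_toInjectiveHull R _).associatedPrimes_subset.trans (hAss k)).trans
        (Set.image_mono (hmono hkj)))
  have hker : ∀ j < i, LinearMap.ker (P.φ j) = LinearMap.ker (P.Φ j) := fun j hj => by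
    rw [P.factorization j hj, LinearMap.ker_comp_of_ker_eq_bot]
    exact LinearMap.ker_eq_bot.2 (P.ν_injective (j + 1) hj)
  have hlast : ∀ k, ∀ f : cosyzygy (ModuleCat.of R R) k →ₗ[R] P.E (i + 1),
      ∃ g : injectiveHull R (cosyzygy (ModuleCat.of R R) k) →ₗ[R] P.E (i + 1),
        g ∘ₗ toInjectiveHull R (cosyzygy (ModuleCat.of R R) k) = f := fun k f => by
    obtain ⟨g, hg⟩ := hE.out _ (isInjectiveHull_toInjectiveHull R _).injective_map f
    exact ⟨g, LinearMap.ext hg⟩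
  -- Descending induction on `j`, with `n = i - j`. The bound `k < j` is what puts `E(℧ᵏ⁺¹R)` in
  -- `𝓘(Y j)`; surjectivity of `Φ j` uses only `k = 0` for `K (j + 1)`.
  have hext : ∀ n j, j + n = i → ∀ k < j, ∀ f : cosyzygy (ModuleCat.of R R) k →ₗ[R] P.K j,
      ∃ g : injectiveHull R (cosyzygy (ModuleCat.of R R) k) →ₗ[R] P.K j,
        g ∘ₗ toInjectiveHull R (cosyzygy (ModuleCat.of R R) k) = f := by
    intro n
    induction n with
    | zero =>
      rintro j rfl k hk f
      exact exists_extension_ker P.precover_last (P.ν_injective j le_rfl) (P.range_ν j le_rfl) k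
        (hcls _ _ hk) (hlast (k + 1)) f
    | succ n ih =>
      intro j hj k hk f
      have hji : j < i := by omega
      exact exists_extension_ker (P.precover j hji) (P.ν_injective j hji.le)
        ((P.range_ν j hji.le).trans (hker j hji)) k (hcls _ _ hk)
        (ih (j + 1) (by omega) (k + 1) (by omega)) f
  have hsurj : ∀ j < i, Function.Surjective (P.Φ j) := fun j hj =>
    (P.precover j hj).surjective (hcls 0 j j.zero_le)
      (hext (i - (j + 1)) (j + 1) (by omega) 0 j.succ_pos)
  have hφ : Function.Surjective (P.φ i) :=
    P.precover_last.surjective (hcls 0 i i.zero_le) (hlast 0)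
  refine ⟨⟨P.ν_injective 0 i.zero_le, LinearMap.exact_iff.2 (P.range_ν 0 i.zero_le).symm,
    fun j hj => LinearMap.exact_iff.2 ?_, hφ⟩, hsurj, hφ⟩
  rw [← P.range_ν (j + 1) hj, P.factorization j hj,
    LinearMap.range_comp_of_range_eq_top _ (LinearMap.range_eq_top.2 (hsurj j hj))]
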